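/- Let $R$ be a $d\times d$ integer matrix all of whose complex eigenvalues have modulus $>1$, let $\mathcal A\subset\mathbb Z^d$ be a finite set with $0\in\mathcal A$ and $\#\mathcal A\ge 2$, and let $(\rho_a)_{a\in\mathcal A}$ be probability weights, i.e. $0<\rho_a<1$ and $\sum_{a\in\mathcal A}\rho_a=1$. Let $\mu$ be the invariant measure of the affine iterated function system $\tau_a(x)=R^{-1}(x+a)$ $(x\in\mathbb R^d,\ a\in\mathcal A)$ with these weights, i.e. the Borel probability measure on $\mathbb R^d$ satisfying $\mu=\sum_{a\in\mathcal A}\rho_a\,(\mu\circ\tau_a^{-1})$. Then there is a countably infinite set $\Lambda\subset\mathbb R^d$ such that, for every $p\in[1,2]$ with conjugate exponent $q$ $\left(\tfrac1p+\tfrac1q=1\right)$, the measure $\nu=\sum_{\lambda\in\Lambda}\delta_\lambda$ is a $(p,q)$-Bessel measure for $\mu$. Here $e_t(x)=e^{2\pi i t\cdot x}$ and $\widehat{f\,d\mu}(t)=\int f(x)e^{-2\pi i t\cdot x}\,d\mu(x)$, and $L^p(\mu)$ carries the semi-inner product $$[f,g]_{L^p(\mu)}=\frac{1}{\|g\|_{L^p(\mu)}^{p-2}}\int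 f\,|g|^{p-1}\,\overline{\operatorname{sgn}(g)}\,d\mu\quad(\|g\|_{L^p(\mu)}\ne0),$$ and $[f,g]_{L^p(\mu)}=0$ if $\|g\|_{L^p(\mu)}=0$, where $\operatorname{sgn}(z)=z/|z|$ for $z\neq 0$ and $\operatorname{sgn}(0)=0$ (so that $[f,e_t]_{L^p(\mu)}=\widehat{f\,d\mu}(t)$ for a probability measure $\mu$). A Borel measure $\nu$ on $\mathbb R^d$ is a $(p,q)$-Bessel measure for $\mu$ if there is a constant $B>0$ such that, for all $f\in L^p(\mu)$, $$\int_{\mathbb R^d}\bigl|[f,e_t]_{L^p(\mu)}\bigr|^q\,d\nu(t)\le B\,\|f\|_{L^p(\mu)}^q\quad(p\ne1),\qquad \bigl\|\widehat{f\,d\mu}\bigr\|_{L^\infty(\nu)}\le B\,\|f\|_{L^1(\mu)}\quad(p=1,\ q=\infty).$$ -/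

import Mathlib

open MeasureTheory
open scoped ENNReal

noncomputable section

namespace PQBessel

/-- The Euclidean space of dimension `d`. -/
abbrev E (d : ℕ) : Type := EuclideanSpace ℝ (Fin d)

/-- The exponential function `e_t(x) = exp(2 π i t · x)`. -/
def expo {d : ℕ} (t x : E d) : ℂ :=
  Complex.exp (2 * (Real.pi : ℂ) * Complex.I * ((inner ℝ t x : ℝ) : ℂ))

/-- The Fourier transform of the complex measure `f dμ`:
`t ↦ ∫ f(x) exp(-2 π i t · x) dμ(x)`. -/
def fourierMeasure {d : ℕ} (μ : Measure (E d)) (f : E d → ℂ) (t : E d) : ℂ :=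
  ∫ x, f x * expo (-t) x ∂μ

/-- The complex sign `z / |z|`, with value `0` at `z = 0`. -/
def sgn (z : ℂ) : ℂ := if z = 0 then 0 else z / ((‖z‖ : ℝ) : ℂ)

/-- The compatible semi-inner product on `L^p(μ)` (used for finite `p ≥ 1`):
`[f,g] = ‖g‖_p^{-(p-2)} ∫ f |g|^{p-1} conj(sgn g) dμ` if `‖g‖_p ≠ 0`,
and `[f,g] = 0` if `‖g‖_p = 0`. -/
def semiInner {d : ℕ} (p : ℝ≥0∞) (μ : Measure (E d)) (f g : E d → ℂ) : ℂ :=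
  if eLpNorm g p μ = 0 then 0
  else
    ((1 / (eLpNorm g p μ).toReal ^ (p.toReal - 2) : ℝ) : ℂ) *
      ∫ x, f x * ((‖g x‖ ^ (p.toReal - 1) : ℝ) : ℂ) * (starRingEnd ℂ) (sgn (g x)) ∂μ

/-- `ν` is a `(p,q)`-Bessel measure for `μ`; here `μ` is a finite Borel measure, `1 ≤ p < ∞`
and `q` is the exponent conjugate to `p` (so that `p = 1` exactly when `q = ∞`).
For `p = 1` the bound is on the norm of the Fourier transform of `f dμ` in `L^∞(ν)`. -/
def IsBesselMeasure {d : ℕ} (p q : ℝ≥0∞) (μ ν : Measure (E d)) : Prop :=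
  ∃ B : ℝ, 0 < B ∧ ∀ f : E d → ℂ, MemLp f p μ →
    if p = 1 then
      eLpNorm (fourierMeasure μ f) ∞ ν ≤ ENNReal.ofReal B * eLpNorm f 1 μ
    else
      ∫⁻ t, ‖semiInner p μ f (expo t)‖ₑ ^ q.toReal ∂ν
        ≤ ENNReal.ofReal B * eLpNorm f p μ ^ q.toReal

/-- The measure `∑_{t ∈ Λ} δ_t`. -/
def diracSum {d : ℕ} (Λ : Set (E d)) : Measure (E d) :=
  Measure.sum fun t : Λ => Measure.dirac (t : E d)

/-- An integer matrix is expansive if all its (complex) eigenvalues have modulus `> 1`. -/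
def IsExpansive {d : ℕ} (R : Matrix (Fin d) (Fin d) ℤ) : Prop :=
  ∀ z ∈ spectrum ℂ (R.map (fun k : ℤ => (k : ℂ))), 1 < ‖z‖

/-- The affine map `τ_a(x) = R⁻¹ (x + a)`. -/
def tau {d : ℕ} (R : Matrix (Fin d) (Fin d) ℤ) (a : Fin d → ℤ) (x : E d) : E d :=
  WithLp.toLp 2 ((R.map (fun k : ℤ => (k : ℝ)))⁻¹.mulVec (fun i => x i + (a i : ℝ)))

/-- `μ` is the invariant measure of the affine iterated function system `(τ_a)_{a ∈ A}` with
weights `(ρ_a)_{a ∈ A}`: a Borel probability measure with `μ = ∑_{a ∈ A} ρ_a (μ ∘ τ_a⁻¹)`.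
For an expansive `R` and probability weights there is exactly one such measure on the whole
space, and it is carried by the attractor. -/
def IsInvariantMeasure {d : ℕ} (R : Matrix (Fin d) (Fin d) ℤ) (A : Finset (Fin d → ℤ))
    (ρ : (Fin d → ℤ) → ℝ) (μ : Measure (E d)) : Prop :=
  IsProbabilityMeasure μ ∧ μ = ∑ a ∈ A, ENNReal.ofReal (ρ a) • μ.map (tau R a)

end PQBessel

end

/-! The system enters only through the absence of atoms. The heaviest atoms of `μ` would form a
finite set permuted by every inverse branch `x ↦ R x - a`, so the sum of its points would force all
digits to coincide (`nullSingletonClass_of_affine_selfSimilar`). For a diffuse `μ`, Wiener's lemma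
makes the mean of `|μ̂|²` over wide Gaussians tend to zero. Frequencies can therefore be picked one
after another, each nearly orthogonal in `L²(μ)` to all earlier ones
(`exists_seq_norm_charFun_sub_le`). Their Gram matrix has bounded row sums, and Schur's test gives
the `(2, 2)` bound. The `(1, ∞)` bound is trivial, and Marcinkiewicz interpolation covers the
exponents between. Since `[f, e_t]` is the same Fourier transform for every `p`, one set of
frequencies serves them all. -/

/-- Schur's test for Bessel sequences: a bound on the row sums of the Gram matrix is a
Bessel bound. -/
theorem sum_norm_inner_sq_le_of_gram_row_sum_le {𝕜 H ι : Type*} [RCLike 𝕜]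
    [NormedAddCommGroup H] [InnerProductSpace 𝕜 H] (v : ι → H) (s : Finset ι) {C : ℝ} (hC0 : 0 ≤ C)
    (hC : ∀ i ∈ s, ∑ j ∈ s, ‖inner 𝕜 (v i) (v j)‖ ≤ C) (f : H) :
    ∑ i ∈ s, ‖inner 𝕜 (v i) f‖ ^ 2 ≤ C * ‖f‖ ^ 2 := by
  set c : ι → 𝕜 := fun i => inner 𝕜 (v i) f with hc
  set S : ℝ := ∑ i ∈ s, ‖c i‖ ^ 2 with hS
  have hS0 : 0 ≤ S := Finset.sum_nonneg fun i _ => sq_nonneg _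
  -- Duality: pairing `x` with `f` returns `S`, so a bound `‖x‖² ≤ C S` gives `S² ≤ C S ‖f‖²`, and
  -- one factor `S` cancels.
  set x : H := ∑ i ∈ s, c i • v i with hx
  have h1 : inner 𝕜 x f = (S : 𝕜) := by
    rw [hx, sum_inner, hS]
    push_cast
    refine Finset.sum_congr rfl fun i _ => ?_
    rw [inner_smul_left, RCLike.conj_mul]
  have h2 : S ≤ ‖x‖ * ‖f‖ := by
    have := norm_inner_le_norm (𝕜 := 𝕜) x f
    rwa [h1, RCLike.norm_ofReal, abs_of_nonneg hS0] at this
  have h3 : ‖x‖ ^ 2 ≤ C * S := by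
    have e1 : ‖x‖ ^ 2 ≤ ∑ i ∈ s, ∑ j ∈ s, ‖c i‖ * ‖c j‖ * ‖inner 𝕜 (v i) (v j)‖ := by
      have : ‖x‖ ^ 2 = ‖inner 𝕜 x x‖ := by
        rw [inner_self_eq_norm_sq_to_K, norm_pow, RCLike.norm_ofReal, abs_norm]
      rw [this, hx, sum_inner]
      refine (norm_sum_le _ _).trans (Finset.sum_le_sum fun i _ => ?_)
      rw [inner_sum]
      refine (norm_sum_le _ _).trans (Finset.sum_le_sum fun j _ => ?_)
      rw [inner_smul_left, inner_smul_right, norm_mul, norm_mul, RCLike.norm_conj, mul_assoc]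
    -- Splitting `|c i| |c j|` by AM-GM and using the symmetry of the Gram moduli turns both halves
    -- into row sums.
    have e2 : ∑ i ∈ s, ∑ j ∈ s, ‖c i‖ * ‖c j‖ * ‖inner 𝕜 (v i) (v j)‖ ≤
        ∑ i ∈ s, ∑ j ∈ s, (‖c i‖ ^ 2 / 2 * ‖inner 𝕜 (v i) (v j)‖ +
          ‖c j‖ ^ 2 / 2 * ‖inner 𝕜 (v j) (v i)‖) := by
      refine Finset.sum_le_sum fun i _ => Finset.sum_le_sum fun j _ => ?_
      rw [norm_inner_symm (v j) (v i), ← add_mul]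
      refine mul_le_mul_of_nonneg_right ?_ (norm_nonneg _)
      nlinarith [sq_nonneg (‖c i‖ - ‖c j‖)]
    have e3 : ∑ i ∈ s, ∑ j ∈ s, (‖c i‖ ^ 2 / 2 * ‖inner 𝕜 (v i) (v j)‖ +
          ‖c j‖ ^ 2 / 2 * ‖inner 𝕜 (v j) (v i)‖) =
        ∑ i ∈ s, ‖c i‖ ^ 2 * ∑ j ∈ s, ‖inner 𝕜 (v i) (v j)‖ := by
      simp_rw [Finset.sum_add_distrib]
      rw [Finset.sum_comm (f := fun i j => ‖c j‖ ^ 2 / 2 * ‖inner 𝕜 (v j) (v i)‖),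
        ← Finset.sum_add_distrib]
      refine Finset.sum_congr rfl fun i _ => ?_
      rw [← Finset.mul_sum]
      ring
    have e4 : ∑ i ∈ s, ‖c i‖ ^ 2 * ∑ j ∈ s, ‖inner 𝕜 (v i) (v j)‖ ≤ C * S := by
      rw [hS, Finset.mul_sum]
      refine Finset.sum_le_sum fun i hi => ?_
      rw [mul_comm C]
      exact mul_le_mul_of_nonneg_left (hC i hi) (sq_nonneg _)
    exact e1.trans (e2.trans (e3.le.trans e4))
  change S ≤ _
  rcases hS0.eq_or_lt with h | h
  · rw [← h]; positivity
  · have h4 : S ^ 2 ≤ C * S * ‖f‖ ^ 2 := by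
      calc S ^ 2 ≤ (‖x‖ * ‖f‖) ^ 2 := by gcongr
        _ = ‖x‖ ^ 2 * ‖f‖ ^ 2 := mul_pow _ _ _
        _ ≤ _ := by gcongr
    nlinarith

/-! ### Absence of atoms for self-similar measures -/

open Classical in
/-- A probability measure whose atoms satisfy the self-similarity relation of an affine
iterated function system with injective linear part and two distinct translations has no atoms. -/
theorem nullSingletonClass_of_affine_selfSimilar {V ι : Type*} [AddCommGroup V] [Module ℝ V]
    [MeasurableSpace V] [MeasurableSingletonClass V] (μ : Measure V) [IsFiniteMeasure μ]
    (A : Finset ι) (w : ι → ℝ) (hw : ∀ a ∈ A, 0 < w a) (hw1 : ∑ a ∈ A, w a = 1)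
    (L : V → V) (hL : Function.Injective L) (b : ι → V)
    (hb : ∃ i ∈ A, ∃ j ∈ A, b i ≠ b j)
    (hμ : ∀ x, μ.real {x} = ∑ a ∈ A, w a * μ.real {L x - b a}) : NullSingletonClass μ := by
  by_contra hno
  obtain ⟨x₀, hx₀⟩ : ∃ x, μ {x} ≠ 0 := by
    by_contra! h
    exact hno ⟨h⟩
  -- Only finitely many points can carry at least a given positive mass, so a heaviest atom exists.
  have hfin : ∀ y, μ {y} ≠ 0 → {x : V | μ {y} ≤ μ {x}}.Finite := fun y hy =>
    Measure.finite_const_le_meas_of_disjoint_iUnion μ (pos_iff_ne_zero.2 hy)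
      (fun x => measurableSet_singleton x)
      (fun x y hxy => by simpa [Function.onFun] using hxy) (measure_ne_top _ _)
  obtain ⟨x₁, hx₁, hmax⟩ := (hfin x₀ hx₀).toFinset.exists_max_image (fun x => μ {x})
    ⟨x₀, by simp⟩
  rw [Set.Finite.mem_toFinset, Set.mem_ofPred_eq] at hx₁
  have hx₁0 : μ {x₁} ≠ 0 := fun h => hx₀ (le_antisymm (h ▸ hx₁) bot_le)
  have hle : ∀ x, μ {x} ≤ μ {x₁} := fun x => by
    by_cases hx : μ {x₀} ≤ μ {x}
    · exact hmax x (by simpa using hx)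
    · exact (not_le.1 hx).le.trans hx₁
  have hle' : ∀ x, μ.real {x} ≤ μ.real {x₁} := fun x =>
    ENNReal.toReal_mono (measure_ne_top _ _) (hle x)
  set M : Finset V := (hfin x₁ hx₁0).toFinset with hM
  have memM : ∀ x, x ∈ M ↔ μ.real {x₁} ≤ μ.real {x} := fun x => by
    rw [hM, Set.Finite.mem_toFinset, Set.mem_ofPred_eq, measureReal_def, measureReal_def,
      ENNReal.toReal_le_toReal (measure_ne_top _ _) (measure_ne_top _ _)]
  -- The maximal mass is an average, with positive weights, of masses that do not exceed it; hence
  -- each of them is maximal.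
  have hmaps : ∀ a ∈ A, ∀ x ∈ M, L x - b a ∈ M := by
    intro a ha x hx
    rw [memM] at hx ⊢
    by_contra hlt
    rw [not_le] at hlt
    have : ∑ a ∈ A, w a * μ.real {L x - b a} < ∑ a ∈ A, w a * μ.real {x₁} :=
      Finset.sum_lt_sum (fun i hi => mul_le_mul_of_nonneg_left (hle' _) (hw i hi).le)
        ⟨a, ha, mul_lt_mul_of_pos_left hlt (hw a ha)⟩
    rw [← hμ, ← Finset.sum_mul, hw1, one_mul] at this
    exact absurd hx (not_le.2 this)
  -- An injective self-map of the finite set `M` permutes it and preserves the sum of its points.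
  -- Hence `M.card • b a` is the same for all `a`.
  have hsum : ∀ a ∈ A, ∑ x ∈ M, (L x - b a) = ∑ x ∈ M, x := by
    intro a ha
    have hinj : Function.Injective fun x => L x - b a := fun x y h => hL (sub_left_injective h)
    have himg : M.image (fun x => L x - b a) = M := by
      refine Finset.eq_of_subset_of_card_le ?_ ?_
      · intro y hy
        obtain ⟨x, hx, rfl⟩ := Finset.mem_image.1 hy
        exact hmaps a ha x hx
      · rw [Finset.card_image_of_injective _ hinj]
    conv_rhs => rw [← himg, Finset.sum_image hinj.injOn]
  obtain ⟨i, hi, j, hj, hij⟩ := hb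
  have h := (hsum i hi).trans (hsum j hj).symm
  simp only [Finset.sum_sub_distrib, Finset.sum_const, sub_right_inj] at h
  have hcard : (M.card : ℝ) ≠ 0 := by
    have : x₁ ∈ M := (memM _).2 le_rfl
    exact_mod_cast Finset.card_ne_zero_of_mem this
  rw [← Nat.cast_smul_eq_nsmul ℝ, ← Nat.cast_smul_eq_nsmul ℝ] at h
  exact hij (smul_right_injective V hcard h)

/-! ### Wiener's lemma and almost orthogonal frequencies -/

section Wiener

open Filter Topology Complex ProbabilityTheory

/-- The difference of two independent copies of a diffuse random variable does not vanish. -/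
theorem conv_map_neg_singleton_zero {V : Type*} [AddCommGroup V] [MeasurableSpace V]
    [MeasurableSingletonClass V] [MeasurableAdd₂ V] [MeasurableNeg V] (μ : Measure V) [IsFiniteMeasure μ] [NullSingletonClass μ] :
    (μ ∗ μ.map Neg.neg) {0} = 0 := by
  have hm : MeasurableSet ((fun p : V × V => p.1 + p.2) ⁻¹' {0}) :=
    measurable_add (measurableSet_singleton 0)
  rw [Measure.conv, Measure.map_apply measurable_add (measurableSet_singleton 0),
    Measure.measure_prod_null hm]
  refine Eventually.of_forall fun x => ?_
  have : Prod.mk x ⁻¹' ((fun p : V × V => p.1 + p.2) ⁻¹' {0}) = {-x} := by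
    ext y
    simp [add_eq_zero_iff_neg_eq, eq_comm]
  change μ.map Neg.neg (Prod.mk x ⁻¹' _) = 0
  rw [this, Measure.map_apply measurable_neg (measurableSet_singleton _)]
  simp

variable {V : Type*} [NormedAddCommGroup V] [InnerProductSpace ℝ V] [MeasurableSpace V]
  [BorelSpace V] [SecondCountableTopology V]

/-- Parseval's relation for characteristic functions. -/
theorem integral_charFun_swap (σ γ : Measure V) [IsFiniteMeasure σ] [IsFiniteMeasure γ] :
    ∫ t, charFun σ t ∂γ = ∫ x, charFun γ x ∂σ := by
  simp only [charFun_apply]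
  rw [integral_integral_swap]
  · simp_rw [real_inner_comm]
  · refine Integrable.of_bound (C := 1) (by fun_prop) (Eventually.of_forall fun z => ?_)
    simp [Function.uncurry, Complex.norm_exp_ofReal_mul_I]

/-- The averages of a characteristic function against probability measures whose own
characteristic functions tend to zero off the origin tend to zero if the origin is not an atom. -/
theorem tendsto_integral_charFun_zero (σ : Measure V) [IsFiniteMeasure σ] (hσ : σ {0} = 0)
    (γ : ℕ → Measure V) [∀ n, IsProbabilityMeasure (γ n)]
    (hγ : ∀ x ≠ 0, Tendsto (fun n => charFun (γ n) x) atTop (𝓝 0)) :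
    Tendsto (fun n => ∫ t, charFun σ t ∂γ n) atTop (𝓝 0) := by
  simp_rw [integral_charFun_swap]
  rw [← integral_zero V ℂ (μ := σ)]
  refine tendsto_integral_of_dominated_convergence (fun _ => 1)
    (fun n => stronglyMeasurable_charFun.aestronglyMeasurable) (integrable_const _)
    (fun n => Eventually.of_forall fun x => norm_charFun_le_one x) ?_
  have : ∀ᵐ x ∂σ, x ≠ 0 := by
    rw [ae_iff]
    simpa using hσ
  filter_upwards [this] with x hx using hγ x hx

/-- Symmetrization makes `|μ̂|²` itself a characteristic function, so its Gaussian means are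
governed by the mass of `μ ∗ μ.map Neg.neg` at the origin. -/
theorem charFun_conv_map_neg (μ : Measure V) [IsFiniteMeasure μ] (t : V) :
    charFun (μ ∗ μ.map Neg.neg) t = ((‖charFun μ t‖ ^ 2 : ℝ) : ℂ) := by
  have h : charFun (μ.map Neg.neg) t = charFun μ (-t) := by
    have := charFun_map_smul (μ := μ) (-1) t
    simpa using this
  rw [charFun_conv, h, charFun_neg, Complex.mul_conj, Complex.normSq_eq_norm_sq]

/-- **Wiener's lemma**, in qualitative form: the characteristic function of a diffuse measure is
simultaneously small on finitely many translates of some point. -/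
theorem exists_forall_norm_charFun_sub_lt [FiniteDimensional ℝ V] (μ : Measure V)
    [IsFiniteMeasure μ] [NullSingletonClass μ] (S : Finset V) {ε : ℝ} (hε : 0 < ε) :
    ∃ t, ∀ s ∈ S, ‖charFun μ (t - s)‖ < ε := by
  -- `γ s n` is the law of `n Z + s` with `Z` standard Gaussian. The shift changes the
  -- characteristic function only by a phase.
  let γ : V → ℕ → Measure V := fun s n => ((stdGaussian V).map ((n : ℝ) • ·)).map (· + s)
  have hγp : ∀ s n, IsProbabilityMeasure (γ s n) := fun s n => by
    have := Measure.isProbabilityMeasure_map (μ := stdGaussian V)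
      (f := ((n : ℝ) • ·)) (by fun_prop)
    exact Measure.isProbabilityMeasure_map (by fun_prop)
  have hγ : ∀ s, ∀ x ≠ 0, Tendsto (fun n => charFun (γ s n) x) atTop (𝓝 0) := by
    intro s x hx
    rw [tendsto_zero_iff_norm_tendsto_zero]
    have h : ∀ n : ℕ, ‖charFun (γ s n) x‖ = Real.exp (-(‖x‖ ^ 2 / 2) * (n : ℝ) ^ 2) := by
      intro n
      simp only [γ]
      rw [charFun_map_add_const, norm_mul, charFun_map_smul, charFun_stdGaussian,
        Complex.norm_exp_ofReal_mul_I, mul_one, norm_smul]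
      rw [Complex.norm_exp]
      congr 1
      simp
      norm_cast
      push_cast
      ring
    simp_rw [h]
    refine Real.tendsto_exp_atBot.comp ?_
    have hx' : -(‖x‖ ^ 2 / 2) < 0 := by
      have := norm_pos_iff.2 hx
      simp only [neg_lt_zero]
      positivity
    exact (tendsto_pow_atTop two_ne_zero |>.comp tendsto_natCast_atTop_atTop).const_mul_atTop_of_neg hx'
  have hmeas : Measurable fun t => ‖charFun μ t‖ ^ 2 := by
    have := measurable_charFun (μ := μ)
    fun_prop
  have hint : ∀ s n, Integrable (fun t => ‖charFun μ (t - s)‖ ^ 2) (γ 0 n) := fun s n => by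
    refine Integrable.of_bound (C := (μ.real Set.univ) ^ 2)
      (hmeas.comp (measurable_sub_const s)).aestronglyMeasurable (Eventually.of_forall fun t => ?_)
    simp only [norm_pow, norm_norm]
    gcongr
    exact norm_charFun_le _
  have key : ∀ s, Tendsto (fun n => ∫ t, ‖charFun μ (t - s)‖ ^ 2 ∂γ 0 n) atTop (𝓝 0) := by
    intro s
    have h := tendsto_integral_charFun_zero (μ ∗ μ.map Neg.neg) (conv_map_neg_singleton_zero μ)
      (γ (-s)) (hγ (-s))
    simp_rw [charFun_conv_map_neg, integral_complex_ofReal] at h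
    have h' : Tendsto (fun n => ∫ t, ‖charFun μ t‖ ^ 2 ∂γ (-s) n) atTop (𝓝 0) := by
      simpa [Function.comp_def] using (Complex.continuous_re.tendsto 0).comp h
    refine h'.congr fun n => ?_
    have e : γ (-s) n = (γ 0 n).map (· - s) := by
      simp [γ, sub_eq_add_neg]
    rw [e, integral_map (by fun_prop) hmeas.aestronglyMeasurable]
  have hsum : Tendsto (fun n => ∫ t, ∑ s ∈ S, ‖charFun μ (t - s)‖ ^ 2 ∂γ 0 n) atTop (𝓝 0) := by
    have := tendsto_finsetSum S fun s _ => key s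
    simp only [Finset.sum_const_zero] at this
    refine this.congr fun n => ?_
    rw [integral_finsetSum _ fun s _ => hint s n]
  obtain ⟨n, hn⟩ := (hsum.eventually (gt_mem_nhds (pow_pos hε 2))).exists
  -- If every `t` failed at some `s`, the sum over `S` would be at least `ε²` everywhere, and so
  -- would its mean.
  by_contra! hcon
  have : ε ^ 2 ≤ ∫ t, ∑ s ∈ S, ‖charFun μ (t - s)‖ ^ 2 ∂γ 0 n := by
    have hc : ∫ _, ε ^ 2 ∂γ 0 n = ε ^ 2 := by simp
    rw [← hc]
    refine integral_mono (integrable_const _) (integrable_finsetSum _ fun s _ => hint s n)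
      fun t => ?_
    obtain ⟨s, hs, hle⟩ := hcon t
    refine (pow_le_pow_left₀ hε.le hle 2).trans ?_
    exact Finset.single_le_sum (f := fun s => ‖charFun μ (t - s)‖ ^ 2)
      (fun _ _ => sq_nonneg _) hs
  exact absurd hn (not_lt.2 this)

/-- There is a sequence along which the characteristic function of a diffuse measure decays
geometrically at all differences. -/
theorem exists_seq_norm_charFun_sub_le [FiniteDimensional ℝ V] (μ : Measure V)
    [IsFiniteMeasure μ] [NullSingletonClass μ] :
    ∃ u : ℕ → V, ∀ m n, m ≠ n → ‖charFun μ (u n - u m)‖ ≤ (1 / 2) ^ (m + 1) * (1 / 2) ^ (n + 1) := by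
  classical
  -- Each point carries a natural number that grows along the sequence, since the relation sees only
  -- the two points and needs a shrinking tolerance. The rate `1/4` leaves a factor `1/2` for each
  -- of the two indices.
  obtain ⟨f, hf, hr⟩ := exists_seq_of_forall_finset_exists (α := ℕ × V) (fun _ => True)
    (fun p q => p.1 < q.1 ∧ ‖charFun μ (q.2 - p.2)‖ < (1 / 4) ^ (q.1 + 1)) fun s _ => by
      obtain ⟨N, hN⟩ : ∃ N, ∀ p ∈ s, p.1 < N :=
        ⟨s.sup Prod.fst + 1, fun p hp => Nat.lt_succ_of_le (Finset.le_sup (f := Prod.fst) hp)⟩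
      obtain ⟨t, ht⟩ := exists_forall_norm_charFun_sub_lt μ (s.image Prod.snd)
        (ε := (1 / 4) ^ (N + 1)) (by positivity)
      exact ⟨(N, t), trivial, fun p hp => ⟨hN p hp, ht _ (Finset.mem_image_of_mem _ hp)⟩⟩
  have hmono : StrictMono fun n => (f n).1 := fun m n h => (hr m n h).1
  have hlt : ∀ m n, m < n →
      ‖charFun μ ((f n).2 - (f m).2)‖ ≤ (1 / 2) ^ (m + 1) * (1 / 2) ^ (n + 1) := by
    intro m n h
    refine (hr m n h).2.le.trans ?_
    calc ((1 : ℝ) / 4) ^ ((f n).1 + 1) ≤ (1 / 4) ^ (n + 1) :=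
          pow_le_pow_of_le_one (by norm_num) (by norm_num) (Nat.succ_le_succ (hmono.le_apply))
      _ = (1 / 2) ^ (n + 1) * (1 / 2) ^ (n + 1) := by rw [← mul_pow]; norm_num
      _ ≤ _ := mul_le_mul_of_nonneg_right
          (pow_le_pow_of_le_one (by norm_num) (by norm_num) (by omega)) (by positivity)
  refine ⟨fun n => (f n).2, fun m n hmn => ?_⟩
  rcases hmn.lt_or_gt with h | h
  · exact hlt m n h
  · have := hlt n m h
    rwa [← neg_sub, charFun_neg, RCLike.norm_conj, mul_comm] at this

end Wiener

/-! ### Marcinkiewicz interpolation -/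

section Interpolation

open Set

variable {α β : Type*} [MeasurableSpace α] [MeasurableSpace β] {μ : Measure α}
  [IsFiniteMeasure μ] {ν : Measure β} {T : (α → ℂ) → β → ℂ}

theorem lintegral_Ioc_rpow {a r : ℝ} (ha : 0 ≤ a) (hr : -1 < r) :
    ∫⁻ t in Ioc 0 a, ENNReal.ofReal (t ^ r) = ENNReal.ofReal (a ^ (r + 1) / (r + 1)) := by
  rw [← ofReal_integral_eq_lintegral_ofReal, ← intervalIntegral.integral_of_le ha,
    integral_rpow (Or.inl hr), Real.zero_rpow (by linarith), sub_zero]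
  · exact (intervalIntegrable_iff_integrableOn_Ioc_of_le ha).1
      (intervalIntegral.intervalIntegrable_rpow' hr)
  · filter_upwards [ae_restrict_mem measurableSet_Ioc] with t ht
    exact Real.rpow_nonneg ht.1.le _

/-- The level set estimate obtained by truncating `f` at height `(2 N / t) ^ (1 / (p - 1))`,
where `N = ∫ ‖f‖ ^ p`. -/
theorem measure_lt_norm_le_of_endpoint_bounds
    (hadd : ∀ f g, Integrable f μ → Integrable g μ → ∀ t, T (f + g) t = T f t + T g t)
    (hmeas : ∀ f, Integrable f μ → AEMeasurable (T f) ν)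
    (h1 : ∀ f, Integrable f μ → ∀ t, ‖T f t‖ ≤ ∫ x, ‖f x‖ ∂μ) {C : ℝ≥0∞}
    (h2 : ∀ f, MemLp f 2 μ → ∫⁻ t, ‖T f t‖ₑ ^ 2 ∂ν ≤ C * ∫⁻ x, ‖f x‖ₑ ^ 2 ∂μ)
    {p : ℝ} (hp : 1 < p) {f : α → ℂ} (hf : Measurable f) (hfp : Integrable (fun x => ‖f x‖ ^ p) μ)
    (hfi : Integrable f μ)
    (hN : 0 < ∫ x, ‖f x‖ ^ p ∂μ) {t : ℝ} (ht : 0 < t) :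
    ν {y | t < ‖T f y‖} ≤ C * ENNReal.ofReal (4 / t ^ 2) *
      ∫⁻ x in {x | t * ‖f x‖ ^ (p - 1) ≤ 2 * ∫ x, ‖f x‖ ^ p ∂μ}, ‖f x‖ₑ ^ 2 ∂μ := by
  set N := ∫ x, ‖f x‖ ^ p ∂μ
  set S : Set α := {x | t * ‖f x‖ ^ (p - 1) ≤ 2 * N} with hSdef
  have hS : MeasurableSet S := measurableSet_le (by fun_prop) measurable_const
  have hf1 : Integrable (Sᶜ.indicator f) μ := hfi.indicator hS.compl
  have hf2 : Integrable (S.indicator f) μ := hfi.indicator hS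
  have hL2 : MemLp (S.indicator f) 2 μ := by
    refine MemLp.of_bound hf2.aestronglyMeasurable ((2 * N / t) ^ (p - 1)⁻¹)
      (Filter.Eventually.of_forall fun x => ?_)
    by_cases hx : x ∈ S
    · rw [indicator_of_mem hx, Real.le_rpow_inv_iff_of_pos (norm_nonneg _) (by positivity)
        (by linarith), le_div_iff₀ ht, mul_comm]
      exact hx
    · rw [indicator_of_notMem hx, norm_zero]
      positivity
  -- Off `S`, multiplying `2 N < t |f|^(p-1)` by `|f|` gives `|f| ≤ t / (2 N) · |f|^p`. So the large
  -- part of `f` contributes at most `t / 2` to `T f`, and Chebyshev is applied to the bounded part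
  -- at height `t / 2`.
  have hone : ∫ x, ‖Sᶜ.indicator f x‖ ∂μ ≤ t / 2 := by
    calc ∫ x, ‖Sᶜ.indicator f x‖ ∂μ ≤ ∫ x, t / (2 * N) * ‖f x‖ ^ p ∂μ := by
          refine integral_mono hf1.norm (hfp.const_mul _) fun x => ?_
          simp only
          by_cases hx : x ∈ S
          · rw [indicator_of_notMem (by simpa using hx), norm_zero]
            positivity
          · rw [indicator_of_mem (by simpa using hx)]
            have hx' : 2 * N < t * ‖f x‖ ^ (p - 1) := not_le.1 hx
            have hfx : 0 < ‖f x‖ := by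
              refine (norm_nonneg _).lt_of_ne fun h => ?_
              rw [← h, Real.zero_rpow (by linarith)] at hx'
              linarith
            have : ‖f x‖ ^ p = ‖f x‖ ^ (p - 1) * ‖f x‖ := by
              rw [← Real.rpow_add_one hfx.ne']
              ring_nf
            rw [this, div_mul_eq_mul_div, le_div_iff₀ (by positivity)]
            nlinarith
      _ = t / 2 := by
          rw [integral_const_mul]
          change t / (2 * N) * N = t / 2
          field_simp
  have hsub : {y | t < ‖T f y‖} ⊆
      {y | ENNReal.ofReal (t ^ 2 / 4) ≤ ‖T (S.indicator f) y‖ₑ ^ 2} := by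
    intro y hy
    have hy' : t < ‖T f y‖ := hy
    have hsplit : T f y = T (S.indicator f) y + T (Sᶜ.indicator f) y := by
      rw [← hadd _ _ hf2 hf1, indicator_self_add_compl]
    have hle := (h1 _ hf1 y).trans hone
    have : t / 2 ≤ ‖T (S.indicator f) y‖ := by
      have := norm_add_le (T (S.indicator f) y) (T (Sᶜ.indicator f) y)
      rw [← hsplit] at this
      linarith
    change ENNReal.ofReal (t ^ 2 / 4) ≤ ‖T (S.indicator f) y‖ₑ ^ 2
    rw [← ofReal_norm, ← ENNReal.ofReal_pow (norm_nonneg _)]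
    exact ENNReal.ofReal_le_ofReal (by nlinarith)
  have hm := hmeas _ hf2
  have ht2 : 0 < t ^ 2 / 4 := by positivity
  calc ν {y | t < ‖T f y‖} ≤ _ := measure_mono hsub
    _ ≤ (∫⁻ y, ‖T (S.indicator f) y‖ₑ ^ 2 ∂ν) / ENNReal.ofReal (t ^ 2 / 4) :=
        meas_ge_le_lintegral_div (by fun_prop) (by simpa using ht2) ENNReal.ofReal_ne_top
    _ ≤ (C * ∫⁻ x, ‖S.indicator f x‖ₑ ^ 2 ∂μ) / ENNReal.ofReal (t ^ 2 / 4) := by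
        gcongr
        exact h2 _ hL2
    _ = _ := by
        have e1 : ∫⁻ x, ‖S.indicator f x‖ₑ ^ 2 ∂μ = ∫⁻ x in S, ‖f x‖ₑ ^ 2 ∂μ := by
          rw [← lintegral_indicator hS]
          refine lintegral_congr fun x => ?_
          by_cases hx : x ∈ S <;> simp [hx]
        rw [e1, div_eq_mul_inv, ← ENNReal.ofReal_inv_of_pos ht2, inv_div]
        ring

/-- **Marcinkiewicz interpolation** between the `(1, ∞)` and `(2, 2)` endpoints. -/
theorem lintegral_rpow_enorm_le_of_endpoint_bounds
    (hadd : ∀ f g, Integrable f μ → Integrable g μ → ∀ t, T (f + g) t = T f t + T g t)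
    (hmeas : ∀ f, Integrable f μ → AEMeasurable (T f) ν)
    (h1 : ∀ f, Integrable f μ → ∀ t, ‖T f t‖ ≤ ∫ x, ‖f x‖ ∂μ) {C : ℝ≥0∞}
    (h2 : ∀ f, MemLp f 2 μ → ∫⁻ t, ‖T f t‖ₑ ^ 2 ∂ν ≤ C * ∫⁻ x, ‖f x‖ₑ ^ 2 ∂μ)
    {p q : ℝ} (hpq : p.HolderConjugate q) (hp2 : p < 2) {f : α → ℂ} (hf : Measurable f)
    (hfp : Integrable (fun x => ‖f x‖ ^ p) μ) (hfi : Integrable f μ) :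
    ∫⁻ y, ‖T f y‖ₑ ^ q ∂ν ≤ C * ENNReal.ofReal
      (q * (4 * 2 ^ (q - 2) / (q - 2)) * (∫ x, ‖f x‖ ^ p ∂μ) ^ (q - 1)) := by
  have hp1 : 1 < p := hpq.lt
  have hq0 : 0 < q := hpq.symm.pos
  have hmul : (p - 1) * (q - 1) = 1 := by
    linear_combination hpq.mul_eq_add
  have hq2 : 2 < q := by nlinarith
  rcases (integral_nonneg fun x => Real.rpow_nonneg (norm_nonneg (f x)) p :
    0 ≤ ∫ x, ‖f x‖ ^ p ∂μ).eq_or_lt with hN | hN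
  -- The truncation degenerates when `N = 0`, but then `f` vanishes almost everywhere and `h1` gives
  -- `T f = 0` everywhere.
  · have hae : ∀ᵐ x ∂μ, ‖f x‖ = 0 := by
      have := (integral_eq_zero_iff_of_nonneg
        (fun x => Real.rpow_nonneg (norm_nonneg (f x)) p) hfp).1 hN.symm
      filter_upwards [this] with x hx
      exact (Real.rpow_eq_zero (norm_nonneg _) (by linarith)).1 hx
    have hT : ∀ y, ‖T f y‖ₑ ^ q = 0 := fun y => by
      have := h1 f hfi y
      rw [integral_congr_ae hae, integral_zero] at this
      simp [norm_le_zero_iff.1 this, hq0]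
    simp [hT]
  set N := ∫ x, ‖f x‖ ^ p ∂μ with hNdef
  -- The layer-cake weight `t^(q-1)` times the factor `4 / t²` of the level set estimate; Tonelli
  -- then allows integration in `t` first.
  set H : ℝ → α → ℝ≥0∞ := fun t x => if t * ‖f x‖ ^ (p - 1) ≤ 2 * N then
    ENNReal.ofReal (t ^ (q - 3)) * ENNReal.ofReal (4 * ‖f x‖ ^ 2) else 0 with hH
  have hHm : Measurable (Function.uncurry H) := by
    refine Measurable.ite (measurableSet_le (by fun_prop) measurable_const) ?_ measurable_const
    fun_prop
  have hlevel : ∀ t ∈ Ioi (0 : ℝ), ν {y | t < ‖T f y‖} * ENNReal.ofReal (t ^ (q - 1)) ≤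
      C * ∫⁻ x, H t x ∂μ := by
    intro t ht
    have ht' : 0 < t := ht
    refine (mul_le_mul_left (measure_lt_norm_le_of_endpoint_bounds hadd hmeas h1 h2 hp1 hf hfp hfi hN
      ht') _).trans_eq ?_
    rw [← lintegral_indicator (measurableSet_le (by fun_prop) measurable_const), mul_assoc,
      mul_assoc, mul_comm (lintegral _ _), ← mul_assoc (ENNReal.ofReal _),
      ← ENNReal.ofReal_mul (by positivity), ← lintegral_const_mul' _ _ ENNReal.ofReal_ne_top]
    congr 1
    refine lintegral_congr fun x => ?_
    by_cases hx : t * ‖f x‖ ^ (p - 1) ≤ 2 * N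
    · rw [indicator_of_mem (by exact hx)]
      simp only [hH, if_pos hx]
      rw [← ofReal_norm, ← ENNReal.ofReal_pow (norm_nonneg _), ← ENNReal.ofReal_mul (by positivity),
        ← ENNReal.ofReal_mul (by positivity)]
      congr 1
      have : t ^ (q - 1) = t ^ (q - 3) * t ^ 2 := by
        rw [← Real.rpow_natCast, ← Real.rpow_add ht']
        congr 1
        push_cast
        ring
      rw [this]
      field_simp
    · rw [indicator_of_notMem (by exact hx)]
      simp only [hH, if_neg hx, mul_zero]
  have hinner : ∀ x, ∫⁻ t in Ioi 0, H t x ≤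
      ENNReal.ofReal (4 * (2 * N) ^ (q - 2) / (q - 2) * ‖f x‖ ^ p) := by
    intro x
    rcases (norm_nonneg (f x)).eq_or_lt with hx | hx
    · have : ∀ t, H t x = 0 := fun t => by simp [hH, norm_eq_zero.1 hx.symm]
      simp [this]
    · have hb : 0 < ‖f x‖ ^ (p - 1) := by positivity
      set a := 2 * N / ‖f x‖ ^ (p - 1) with ha
      have ha0 : 0 < a := by positivity
      have e1 : ∫⁻ t in Ioi 0, H t x = ∫⁻ t in Ioc 0 a,
          ENNReal.ofReal (t ^ (q - 3)) * ENNReal.ofReal (4 * ‖f x‖ ^ 2) := by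
        rw [← lintegral_indicator measurableSet_Ioi, ← lintegral_indicator measurableSet_Ioc]
        refine lintegral_congr fun t => ?_
        by_cases h0 : 0 < t
        · rw [indicator_of_mem (by exact h0)]
          by_cases hta : t ≤ a
          · rw [indicator_of_mem (by exact ⟨h0, hta⟩)]
            simp only [hH, if_pos ((le_div_iff₀ hb).1 hta)]
          · rw [indicator_of_notMem (fun h => hta h.2)]
            simp only [hH]
            rw [if_neg fun h => hta ((le_div_iff₀ hb).2 h)]
        · rw [indicator_of_notMem (by exact h0), indicator_of_notMem (fun h => h0 h.1)]
      -- Integrability of `t^(q-3)` at zero is where `q > 2` is needed.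
      rw [e1, lintegral_mul_const' _ _ ENNReal.ofReal_ne_top,
        lintegral_Ioc_rpow ha0.le (by linarith), ← ENNReal.ofReal_mul (by
          have : 0 < q - 3 + 1 := by linarith
          positivity)]
      refine le_of_eq ?_
      congr 1
      -- The powers of `|f|` combine because `(p - 1)(q - 2) = 2 - p`.
      have e2 : a ^ (q - 2) * ‖f x‖ ^ 2 = (2 * N) ^ (q - 2) * ‖f x‖ ^ p := by
        rw [ha, Real.div_rpow (by positivity) hb.le, ← Real.rpow_mul hx.le,
          div_mul_eq_mul_div, div_eq_iff (by positivity), mul_assoc, ← Real.rpow_natCast,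
          ← Real.rpow_add hx]
        congr 2
        push_cast
        nlinarith
      have e3 : q - 3 + 1 = q - 2 := by ring
      rw [e3]
      calc a ^ (q - 2) / (q - 2) * (4 * ‖f x‖ ^ 2)
          = 4 * (a ^ (q - 2) * ‖f x‖ ^ 2) / (q - 2) := by ring
        _ = _ := by rw [e2]; ring
  have hTm := hmeas f hfi
  calc ∫⁻ y, ‖T f y‖ₑ ^ q ∂ν = ∫⁻ y, ENNReal.ofReal (‖T f y‖ ^ q) ∂ν := by
        refine lintegral_congr fun y => ?_
        rw [← ofReal_norm, ENNReal.ofReal_rpow_of_nonneg (norm_nonneg _) hq0.le]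
    _ = ENNReal.ofReal q *
          ∫⁻ t in Ioi 0, ν {y | t < ‖T f y‖} * ENNReal.ofReal (t ^ (q - 1)) :=
        lintegral_rpow_eq_lintegral_meas_lt_mul ν
          (Filter.Eventually.of_forall fun _ => norm_nonneg _) hTm.norm hq0
    _ ≤ ENNReal.ofReal q * ∫⁻ t in Ioi 0, C * ∫⁻ x, H t x ∂μ := by
        exact mul_le_mul' le_rfl (setLIntegral_mono' measurableSet_Ioi hlevel)
    _ = C * (ENNReal.ofReal q * ∫⁻ x, (∫⁻ t in Ioi 0, H t x) ∂μ) := by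
        have hHt : Measurable fun t => ∫⁻ x, H t x ∂μ := hHm.lintegral_prod_right'
        rw [lintegral_const_mul C hHt, lintegral_lintegral_swap hHm.aemeasurable]
        ring
    _ ≤ C * (ENNReal.ofReal q * ∫⁻ x,
          ENNReal.ofReal (4 * (2 * N) ^ (q - 2) / (q - 2) * ‖f x‖ ^ p) ∂μ) := by
        exact mul_le_mul' le_rfl (mul_le_mul' le_rfl (lintegral_mono hinner))
    _ = _ := by
        have hq2' : 0 < q - 2 := by linarith
        rw [← ofReal_integral_eq_lintegral_ofReal (hfp.const_mul _)
          (Filter.Eventually.of_forall fun x => by positivity), integral_const_mul,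
          ← ENNReal.ofReal_mul hq0.le, ← hNdef]
        congr 2
        have : N ^ (q - 1) = N ^ (q - 2) * N := by
          rw [← Real.rpow_add_one hN.ne']
          ring_nf
        rw [Real.mul_rpow (by norm_num) hN.le, this]
        ring

end Interpolation

namespace PQBessel

/-! ### Exponentials in `L²(μ)` -/

section Exponentials

variable {d : ℕ} (μ : Measure (E d))

theorem norm_expo (t x : E d) : ‖expo t x‖ = 1 := by
  have h : expo t x = Complex.exp (((2 * Real.pi * inner ℝ t x : ℝ) : ℂ) * Complex.I) := by
    rw [expo]
    congr 1
    push_cast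
    ring
  rw [h, Complex.norm_exp_ofReal_mul_I]

theorem continuous_expo (t : E d) : Continuous (expo t) := by
  unfold expo
  fun_prop

theorem expo_ne_zero (t x : E d) : expo t x ≠ 0 := Complex.exp_ne_zero _

theorem conj_expo (t x : E d) : (starRingEnd ℂ) (expo t x) = expo (-t) x := by
  rw [expo, expo, ← Complex.exp_conj]
  congr 1
  simp [Complex.conj_ofNat]

theorem expo_neg_mul_expo (s t x : E d) :
    expo (-s) x * expo t x = Complex.exp (inner ℝ x ((2 * Real.pi) • (t - s)) * Complex.I) := by
  rw [expo, expo, ← Complex.exp_add]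
  congr 1
  rw [inner_smul_right, inner_sub_right, inner_neg_left, real_inner_comm s, real_inner_comm t]
  push_cast
  ring

theorem eLpNorm_expo [IsProbabilityMeasure μ] (t : E d) {p : ℝ≥0∞} (hp : p ≠ 0) :
    eLpNorm (expo t) p μ = 1 := by
  rw [eLpNorm_congr_norm_ae (g := fun _ => (1 : ℂ))
    (Filter.Eventually.of_forall fun x => by rw [norm_expo, norm_one]),
    eLpNorm_const _ hp (IsProbabilityMeasure.ne_zero μ)]
  simp

/-- As `|e_t| = 1` and `μ` has mass one, the weight and the normalization both equal `1`. This
leaves a single linear operator, independent of `p`, which is what interpolation requires. -/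
theorem semiInner_expo [IsProbabilityMeasure μ] (f : E d → ℂ) (t : E d) {p : ℝ≥0∞} (hp : p ≠ 0) :
    semiInner p μ f (expo t) = fourierMeasure μ f t := by
  rw [semiInner, eLpNorm_expo μ t hp, if_neg one_ne_zero, fourierMeasure]
  simp [norm_expo, sgn, expo_ne_zero, conj_expo]

variable {μ}

theorem integrable_mul_expo {f : E d → ℂ} (hf : Integrable f μ) (t : E d) :
    Integrable (fun x => f x * expo t x) μ :=
  hf.mul_bdd (c := 1) (continuous_expo t).measurable.aestronglyMeasurable
    (Filter.Eventually.of_forall fun x => (norm_expo t x).le)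

theorem fourierMeasure_add {f g : E d → ℂ} (hf : Integrable f μ) (hg : Integrable g μ) (t : E d) :
    fourierMeasure μ (f + g) t = fourierMeasure μ f t + fourierMeasure μ g t := by
  simp only [fourierMeasure, Pi.add_apply, add_mul]
  exact integral_add (integrable_mul_expo hf _) (integrable_mul_expo hg _)

theorem fourierMeasure_congr_ae {f g : E d → ℂ} (h : f =ᵐ[μ] g) :
    fourierMeasure μ f = fourierMeasure μ g := by
  ext t
  refine integral_congr_ae ?_
  filter_upwards [h] with x hx
  rw [hx]

theorem norm_fourierMeasure_le (f : E d → ℂ) (t : E d) :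
    ‖fourierMeasure μ f t‖ ≤ ∫ x, ‖f x‖ ∂μ := by
  refine (norm_integral_le_integral_norm _).trans_eq ?_
  simp [norm_expo]

theorem enorm_fourierMeasure_le (f : E d → ℂ) (t : E d) :
    ‖fourierMeasure μ f t‖ₑ ≤ eLpNorm f 1 μ := by
  refine (enorm_integral_le_lintegral_enorm _).trans_eq ?_
  rw [eLpNorm_one_eq_lintegral_enorm]
  refine lintegral_congr fun x => ?_
  rw [enorm_mul, ← ofReal_norm (expo (-t) x), norm_expo, ENNReal.ofReal_one, mul_one]

theorem memLp_expo [IsFiniteMeasure μ] (t : E d) (p : ℝ≥0∞) : MemLp (expo t) p μ :=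
  MemLp.of_bound (continuous_expo t).measurable.aestronglyMeasurable 1
    (Filter.Eventually.of_forall fun x => (norm_expo t x).le)

theorem inner_toLp_expo [IsFiniteMeasure μ] {f : E d → ℂ} (hf : MemLp f 2 μ) (t : E d) :
    inner ℂ ((memLp_expo (μ := μ) t 2).toLp _) (hf.toLp _) = fourierMeasure μ f t := by
  rw [L2.inner_def, fourierMeasure]
  refine integral_congr_ae ?_
  filter_upwards [(memLp_expo (μ := μ) t 2).coeFn_toLp, hf.coeFn_toLp] with x h1 h2
  rw [h1, h2, RCLike.inner_apply, conj_expo]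

/-- These are the Gram matrix entries of the exponentials; the factor `2π` reconciles `expo` with
the convention of `charFun`. -/
theorem fourierMeasure_expo (s t : E d) :
    fourierMeasure μ (expo t) s = charFun μ ((2 * Real.pi) • (t - s)) := by
  rw [fourierMeasure, charFun_apply]
  refine integral_congr_ae (Filter.Eventually.of_forall fun x => ?_)
  simp only
  rw [mul_comm, expo_neg_mul_expo]

/-- Exponentials whose frequencies are almost orthogonal form a Bessel sequence in `L²(μ)`. -/
theorem tsum_enorm_fourierMeasure_sq_le [IsProbabilityMeasure μ] (l : ℕ → E d)
    (hl : ∀ m n, m ≠ n → ‖charFun μ ((2 * Real.pi) • (l n - l m))‖ ≤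
      (1 / 2) ^ (m + 1) * (1 / 2) ^ (n + 1)) {f : E d → ℂ} (hf : MemLp f 2 μ) :
    ∑' n, ‖fourierMeasure μ f (l n)‖ₑ ^ 2 ≤ 2 * eLpNorm f 2 μ ^ 2 := by
  let v : ℕ → Lp ℂ 2 μ := fun n => (memLp_expo (l n) 2).toLp _
  have hv : ∀ m n, inner ℂ (v m) (v n) = charFun μ ((2 * Real.pi) • (l n - l m)) := fun m n => by
    rw [inner_toLp_expo (memLp_expo (l n) 2) (l m), fourierMeasure_expo]
  have hgeom : ∀ s : Finset ℕ, ∑ n ∈ s, (1 / 2 : ℝ) ^ (n + 1) ≤ 1 := fun s => by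
    have h : HasSum (fun n : ℕ => (1 / 2 : ℝ) ^ (n + 1)) 1 := by
      have := (hasSum_geometric_two).mul_right (1 / 2 : ℝ)
      simpa [pow_succ] using this
    exact sum_le_hasSum s (fun _ _ => by positivity) h
  have hrow : ∀ s : Finset ℕ, ∀ i ∈ s, ∑ j ∈ s, ‖inner ℂ (v i) (v j)‖ ≤ 2 := by
    intro s i hi
    -- The diagonal entry and the geometric off-diagonal sum contribute at most `1` each, hence the
    -- constant `2`.
    rw [← Finset.add_sum_erase s _ hi]
    have h1 : ‖inner ℂ (v i) (v i)‖ ≤ 1 := by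
      rw [hv]
      exact norm_charFun_le_one _
    have h2 : ∑ j ∈ s.erase i, ‖inner ℂ (v i) (v j)‖ ≤
        (1 / 2 : ℝ) ^ (i + 1) * ∑ j ∈ s.erase i, (1 / 2 : ℝ) ^ (j + 1) := by
      rw [Finset.mul_sum]
      refine Finset.sum_le_sum fun j hj => ?_
      rw [hv]
      exact hl i j (Finset.ne_of_mem_erase hj).symm
    have h3 : (1 / 2 : ℝ) ^ (i + 1) ≤ 1 := pow_le_one₀ (by norm_num) (by norm_num)
    have h4 : (1 / 2 : ℝ) ^ (i + 1) * ∑ j ∈ s.erase i, (1 / 2 : ℝ) ^ (j + 1) ≤ 1 :=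
      mul_le_one₀ h3 (by positivity) (hgeom _)
    linarith
  rw [ENNReal.tsum_eq_iSup_sum]
  refine iSup_le fun s => ?_
  have h := sum_norm_inner_sq_le_of_gram_row_sum_le v s zero_le_two (hrow s) (hf.toLp f)
  have he : eLpNorm f 2 μ = ENNReal.ofReal ‖hf.toLp f‖ := by
    rw [ofReal_norm, Lp.enorm_toLp]
  calc ∑ n ∈ s, ‖fourierMeasure μ f (l n)‖ₑ ^ 2
      = ENNReal.ofReal (∑ n ∈ s, ‖inner ℂ (v n) (hf.toLp f)‖ ^ 2) := by
        rw [ENNReal.ofReal_sum_of_nonneg fun _ _ => sq_nonneg _]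
        refine Finset.sum_congr rfl fun n _ => ?_
        rw [inner_toLp_expo hf, ENNReal.ofReal_pow (norm_nonneg _), ofReal_norm]
    _ ≤ ENNReal.ofReal (2 * ‖hf.toLp f‖ ^ 2) := ENNReal.ofReal_le_ofReal h
    _ = _ := by
        rw [he, ENNReal.ofReal_mul zero_le_two, ENNReal.ofReal_pow (norm_nonneg _)]
        simp

end Exponentials

/-! ### The invariant measure is diffuse -/

section SelfAffine

variable {d : ℕ} {R : Matrix (Fin d) (Fin d) ℤ}

/-- Zero is not an eigenvalue, and the determinant is the same integer over `ℂ` and `ℝ`. -/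
theorem IsExpansive.isUnit_det (hR : IsExpansive R) :
    IsUnit (R.map (fun k : ℤ => (k : ℝ))).det := by
  have h0 : (0 : ℂ) ∉ spectrum ℂ (R.map (fun k : ℤ => (k : ℂ))) := fun h => by
    have := hR 0 h
    norm_num at this
  rw [spectrum.zero_mem_iff, not_not, Matrix.isUnit_iff_isUnit_det] at h0
  have hc : (R.map (fun k : ℤ => (k : ℂ))).det = (R.det : ℂ) :=
    ((Int.castRingHom ℂ).map_det R).symm
  have hr : (R.map (fun k : ℤ => (k : ℝ))).det = (R.det : ℝ) :=
    ((Int.castRingHom ℝ).map_det R).symm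
  rw [hc, isUnit_iff_ne_zero] at h0
  rw [hr, isUnit_iff_ne_zero]
  exact_mod_cast h0

/-- The invariant measure of an expansive affine iterated function system with at least two
digits has no atoms. -/
theorem IsInvariantMeasure.nullSingletonClass (hR : IsExpansive R) {A : Finset (Fin d → ℤ)}
    (hA : 2 ≤ A.card) {ρ : (Fin d → ℤ) → ℝ} (hρ : ∀ a ∈ A, 0 < ρ a) (hρ1 : ∑ a ∈ A, ρ a = 1)
    {μ : Measure (E d)} (hμ : IsInvariantMeasure R A ρ μ) : NullSingletonClass μ := by
  have := hμ.1
  set M := R.map (fun k : ℤ => (k : ℝ)) with hM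
  have hdet : IsUnit M.det := hR.isUnit_det
  let L : E d → E d := fun x => WithLp.toLp 2 (M.mulVec x.ofLp)
  let b : (Fin d → ℤ) → E d := fun a => WithLp.toLp 2 fun i => (a i : ℝ)
  have htau : ∀ a, Measurable (tau R a) := fun a => by
    have : Continuous (tau R a) := by
      unfold tau
      fun_prop
    exact this.measurable
  have hleft : ∀ a x, tau R a (L x - b a) = x := fun a x => by
    have h : (fun i => (L x - b a) i + (a i : ℝ)) = M.mulVec x.ofLp := by
      ext i
      simp [L, b]
    rw [tau, h, Matrix.mulVec_mulVec, Matrix.nonsing_inv_mul _ hdet, Matrix.one_mulVec]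
  have hright : ∀ a y, L (tau R a y) - b a = y := fun a y => by
    ext i
    simp only [L, b, tau, Matrix.mulVec_mulVec, Matrix.mul_nonsing_inv _ hdet, Matrix.one_mulVec,
      ← hM]
    simp
  -- `x ↦ L x - b a` inverts `tau R a`, so invariance of `μ` evaluated at a point becomes the
  -- relation between masses of points.
  have hpre : ∀ a x, tau R a ⁻¹' {x} = {L x - b a} := fun a x => by
    ext y
    simp only [Set.mem_preimage, Set.mem_singleton_iff]
    constructor
    · rintro rfl
      exact (hright a y).symm
    · rintro rfl
      exact hleft a x
  have hL : Function.Injective L := fun x y h => by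
    rw [← hleft 0 x, h, hleft]
  have hb : Function.Injective b := fun a a' h => by
    ext i
    have : (a i : ℝ) = a' i := congrArg (fun v : E d => v i) h
    exact_mod_cast this
  obtain ⟨i, hi, j, hj, hij⟩ := Finset.one_lt_card.1 hA
  refine nullSingletonClass_of_affine_selfSimilar μ A ρ hρ hρ1 L hL b
    ⟨i, hi, j, hj, hb.ne hij⟩ fun x => ?_
  have hx : μ {x} = ∑ a ∈ A, ENNReal.ofReal (ρ a) * μ {L x - b a} := by
    conv_lhs => rw [hμ.2]
    rw [Measure.finsetSum_apply]
    refine Finset.sum_congr rfl fun a _ => ?_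
    rw [Measure.smul_apply, Measure.map_apply (htau a) (measurableSet_singleton x), hpre,
      smul_eq_mul]
  rw [measureReal_def, hx, ENNReal.toReal_sum fun a _ =>
    ENNReal.mul_ne_top ENNReal.ofReal_ne_top (measure_ne_top _ _)]
  refine Finset.sum_congr rfl fun a ha => ?_
  rw [ENNReal.toReal_mul, ENNReal.toReal_ofReal (hρ a ha).le, measureReal_def]

end SelfAffine

/-! ### From the `L²` bound to all exponents -/

section Bessel

variable {d : ℕ} {μ : Measure (E d)} [IsProbabilityMeasure μ]

/-- A purely atomic measure satisfying the `(2, 2)` Bessel bound is a `(p, q)`-Bessel measure for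
all conjugate exponents with `1 ≤ p ≤ 2`. -/
theorem isBesselMeasure_diracSum {Λ : Set (E d)} (hΛ : Λ.Countable)
    (h2 : ∀ f : E d → ℂ, MemLp f 2 μ →
      ∫⁻ t, ‖fourierMeasure μ f t‖ₑ ^ 2 ∂(diracSum Λ) ≤ 2 * eLpNorm f 2 μ ^ 2)
    {p q : ℝ≥0∞} (hp1 : 1 ≤ p) (hp2 : p ≤ 2) (hpq : ENNReal.HolderConjugate p q) :
    IsBesselMeasure p q μ (diracSum Λ) := by
  have := hΛ.to_subtype
  have hp0 : p ≠ 0 := (zero_lt_one.trans_le hp1).ne'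
  have hptop : p ≠ ∞ := (hp2.trans_lt (by simp)).ne
  rcases eq_or_ne p 1 with rfl | hp1'
  · refine ⟨1, one_pos, fun f _ => ?_⟩
    rw [if_pos rfl, ENNReal.ofReal_one, one_mul, eLpNorm_exponent_top]
    exact essSup_le_of_ae_le _ (Filter.Eventually.of_forall fun t => enorm_fourierMeasure_le f t)
  have hpr : 1 < p.toReal := by
    rw [← ENNReal.toReal_one]
    exact (ENNReal.toReal_lt_toReal (by simp) hptop).2 (lt_of_le_of_ne hp1 (Ne.symm hp1'))
  -- The exponent `2` is kept apart because the interpolation constant contains `1 / (q - 2)`.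
  rcases eq_or_ne p 2 with rfl | hp2'
  · have hq : q = 2 := ENNReal.HolderConjugate.unique 2 q 2
    subst hq
    refine ⟨2, two_pos, fun f hf => ?_⟩
    rw [if_neg hp1']
    simp_rw [semiInner_expo μ _ _ hp0]
    simpa using h2 f hf
  have hpr2 : p.toReal < 2 := by
    have := (ENNReal.toReal_lt_toReal hptop (by simp)).2 (lt_of_le_of_ne hp2 hp2')
    simpa using this
  have hconj : p.toReal.HolderConjugate q.toReal := ENNReal.HolderConjugate.toReal hpr
  have hq2 : 0 < q.toReal - 2 := by nlinarith [hconj.mul_eq_add, hconj.symm.pos]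
  have hq0 : 0 < q.toReal := hconj.symm.pos
  refine ⟨2 * (q.toReal * (4 * 2 ^ (q.toReal - 2) / (q.toReal - 2))), ?_, fun f hf => ?_⟩
  · positivity
  rw [if_neg hp1']
  simp_rw [semiInner_expo μ _ _ hp0]
  -- Interpolation is stated for measurable functions, and the Fourier transform depends only on the
  -- class of `f`.
  obtain ⟨g, hgm, hfg⟩ := hf.1
  rw [fourierMeasure_congr_ae hfg, eLpNorm_congr_ae hfg]
  replace hf : MemLp g p μ := hf.ae_eq hfg
  clear hfg f
  have hgp := hf.integrable_norm_rpow hp0 hptop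
  have key := lintegral_rpow_enorm_le_of_endpoint_bounds (μ := μ) (ν := diracSum Λ)
    (T := fourierMeasure μ) (C := 2)
    (fun f g hf hg t => fourierMeasure_add hf hg t)
    (fun f _ => (aemeasurable_sum_measure_iff).2 fun _ => aemeasurable_dirac)
    (fun f _ t => norm_fourierMeasure_le f t)
    (fun f hf => by
      refine (h2 f hf).trans_eq ?_
      rw [eLpNorm_eq_lintegral_rpow_enorm_toReal two_ne_zero (by simp), ← ENNReal.rpow_natCast,
        ← ENNReal.rpow_mul]
      simp)
    hconj hpr2 hgm.measurable hgp (hf.integrable hp1)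
  refine key.trans_eq ?_
  have hN : 0 ≤ ∫ x, ‖g x‖ ^ p.toReal ∂μ := integral_nonneg fun x => by positivity
  -- Identifies `‖g‖_p^q = N^(q/p)` with the power `N^(q-1)` produced by interpolation.
  have hexp : p.toReal⁻¹ * q.toReal = q.toReal - 1 := by
    have := hconj.pos.ne'
    field_simp
    linear_combination -hconj.mul_eq_add
  rw [hf.eLpNorm_eq_integral_rpow_norm hp0 hptop, ENNReal.ofReal_rpow_of_nonneg (by positivity)
    hq0.le, ← Real.rpow_mul hN, hexp, ENNReal.ofReal_mul (by positivity),
    ENNReal.ofReal_mul (p := 2) zero_le_two, ENNReal.ofReal_ofNat, mul_assoc]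

/-- For every diffuse probability measure there is an infinite set of frequencies whose counting
measure is a `(p, q)`-Bessel measure for all conjugate exponents with `1 ≤ p ≤ 2`. -/
theorem exists_infinite_isBesselMeasure_diracSum [NullSingletonClass μ] :
    ∃ Λ : Set (E d), Λ.Infinite ∧ Λ.Countable ∧
      ∀ p q : ℝ≥0∞, 1 ≤ p → p ≤ 2 → ENNReal.HolderConjugate p q →
        IsBesselMeasure p q μ (diracSum Λ) := by
  obtain ⟨u, hu⟩ := exists_seq_norm_charFun_sub_le μ
  let l : ℕ → E d := fun n => (2 * Real.pi)⁻¹ • u n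
  have hpi : (2 * Real.pi) ≠ 0 := by positivity
  have hlu : ∀ m n, (2 * Real.pi) • (l n - l m) = u n - u m := fun m n => by
    simp only [l, ← smul_sub, smul_inv_smul₀ hpi]
  -- Two equal frequencies would give `charFun μ 0 = 1`, against a bound smaller than `1`.
  have hinj : Function.Injective l := fun m n hmn => by
    by_contra hne
    have h := hu m n hne
    rw [← hlu, hmn, sub_self, smul_zero, charFun_zero] at h
    have h1 : (1 / 2 : ℝ) ^ (m + 1) < 1 := pow_lt_one₀ (by norm_num) (by norm_num) (by omega)
    have h2 : (1 / 2 : ℝ) ^ (n + 1) ≤ 1 := pow_le_one₀ (by norm_num) (by norm_num)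
    have h3 := mul_lt_one_of_nonneg_of_lt_one_left (by positivity) h1 h2
    simp only [probReal_univ, Complex.ofReal_one, norm_one] at h
    linarith
  refine ⟨Set.range l, Set.infinite_range_of_injective hinj, Set.countable_range l,
    fun p q hp1 hp2 hpq => isBesselMeasure_diracSum (Set.countable_range l) (fun f hf => ?_)
      hp1 hp2 hpq⟩
  rw [diracSum, lintegral_sum_measure]
  simp_rw [lintegral_dirac]
  rw [tsum_range (fun t => ‖fourierMeasure μ f t‖ₑ ^ 2) hinj]
  exact tsum_enorm_fourierMeasure_sq_le l (fun m n hmn => by rw [hlu]; exact hu m n hmn) hf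

end Bessel

end PQBessel

theorem mainTheorem4 (d : ℕ) (R : Matrix (Fin d) (Fin d) ℤ) (hR : PQBessel.IsExpansive R)
    (A : Finset (Fin d → ℤ)) (hA0 : (0 : Fin d → ℤ) ∈ A) (hA : 2 ≤ A.card)
    (ρ : (Fin d → ℤ) → ℝ) (hρ : ∀ a ∈ A, 0 < ρ a ∧ ρ a < 1) (hρ1 : ∑ a ∈ A, ρ a = 1)
    (μ : Measure (PQBessel.E d)) (hμ : PQBessel.IsInvariantMeasure R A ρ μ) :
    ∃ Λ : Set (PQBessel.E d), Λ.Infinite ∧ Λ.Countable ∧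
      ∀ p q : ℝ≥0∞, 1 ≤ p → p ≤ 2 → ENNReal.HolderConjugate p q →
        PQBessel.IsBesselMeasure p q μ (PQBessel.diracSum Λ) := by
  have := hμ.1
  have := hμ.nullSingletonClass hR hA (fun a ha => (hρ a ha).1) hρ1
  exact PQBessel.exists_infinite_isBesselMeasure_diracSum
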